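/- Let $K$ be a field and let $v$ be a (Krull) valuation on $K$, with arbitrary value group $vK=v(K^\times)$ (written additively), valuation ring $\mathcal O_v$ with maximal ideal $\mathfrak m_v$, and residue field $Kv=\mathcal O_v/\mathfrak m_v$. Denote by $K^{\times 2}$ the set of squares of elements of $K^\times$. A quadratic form $\varphi$ over a field $F$ is called hyperbolic if it is isometric to an orthogonal sum of finitely many (possibly zero) copies of the hyperbolic plane $X_1X_2$. If $\mathrm{char}(F)\neq 2$, then $\varphi$ is called a torsion form if, for some integer $m\geq 1$, the $m$-fold orthogonal sum $\varphi\perp\ldots\perp\varphi$ is hyperbolic; if $\mathrm{char}(F)=2$, every quadratic form over $F$ is by convention a torsion form. The general (Elman--Lam) $u$-invariant of $F$ is $$u(F)=\sup\{\dim(\varphi)\mid \varphi \text{ an anisotropic torsion form over } F\}\in\mathbb N\cup\{\infty\},$$ where the $0$-dimensional form is included. Assume that $1+\mathfrak m_v\subseteq K^{\times 2}$ and $\mathrm{char}(Kv)\neq 2$. Then $$u(K)=[vK:2vK]\cdot u(Kv)$$ in $\mathbb N\cup\{\infty\}$, with the convention $\infty\cdot 0=0$. -/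

import Mathlib

noncomputable section

/-- The hyperbolic plane over `K`: the quadratic form `X₁ X₂` in two variables. -/
def hyperbolicPlane (K : Type*) [Field K] : QuadraticForm K (K × K) :=
  QuadraticMap.linMulLin (LinearMap.fst K K K) (LinearMap.snd K K K)

/-- The `m`-fold orthogonal sum `m × φ = φ ⊥ … ⊥ φ` of a quadratic form with itself. -/
def QuadraticForm.multiple {K V : Type*} [Field K] [AddCommGroup V] [Module K V]
    (m : ℕ) (φ : QuadraticForm K V) : QuadraticForm K (Fin m → V) :=
  QuadraticMap.pi fun _ : Fin m => φ

/-- A quadratic form is hyperbolic if it is isometric to an orthogonal sum of finitely many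
(possibly zero) hyperbolic planes. -/
def QuadraticForm.IsHyperbolic {K V : Type*} [Field K] [AddCommGroup V] [Module K V]
    (φ : QuadraticForm K V) : Prop :=
  ∃ m : ℕ, QuadraticMap.Equivalent φ (QuadraticForm.multiple m (hyperbolicPlane K))

/-- In characteristic different from `2`, a quadratic form is a torsion form if one of its positive
multiples `m × φ` is hyperbolic. In characteristic `2`, every quadratic form is, by convention, a
torsion form. -/
def QuadraticForm.IsTorsionForm {K V : Type*} [Field K] [AddCommGroup V] [Module K V]
    (φ : QuadraticForm K V) : Prop :=
  ringChar K = 2 ∨ ∃ m : ℕ, 0 < m ∧ QuadraticForm.IsHyperbolic (QuadraticForm.multiple m φ)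

/-- The general `u`-invariant of a field: the supremum in `ℕ ∪ {∞}` of the
dimensions of anisotropic torsion forms. -/
def generalUInvariant (K : Type*) [Field K] : ℕ∞ :=
  sSup {d : ℕ∞ | ∃ (n : ℕ) (φ : QuadraticForm K (Fin n → K)),
    φ.Anisotropic ∧ QuadraticForm.IsTorsionForm φ ∧ d = n}

/-- The index `[vK : 2vK]` in `ℕ ∪ {∞}`. Value groups are written multiplicatively in Mathlib, so
`2vK` is the subgroup of squares of the value group `vK = v(Kˣ)`. -/
def valueGroupIndexTwo {K Γ₀ : Type*} [Field K] [LinearOrderedCommGroupWithZero Γ₀]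
    (v : Valuation K Γ₀) : ℕ∞ :=
  ENat.card (MonoidWithZeroHom.valueGroup (.ofClass v : K →*₀ Γ₀) ⧸
    (powMonoidHom 2 : MonoidWithZeroHom.valueGroup (.ofClass v : K →*₀ Γ₀) →*
      MonoidWithZeroHom.valueGroup (.ofClass v : K →*₀ Γ₀)).range)

end

/-!
Over a field of characteristic not two every nondegenerate form is diagonal, so the argument is
about diagonal forms `⟨w i⟩_i`. Grouping the entries by the class of their valuation in `vK/2vK`
writes a form over `K` as `⊥_q c q ⟨u q⟩`, where the `c q ∈ Kˣ` represent distinct classes and the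
`u q` are families of units of the valuation ring (`exists_sigma_equivalent`). The forms `⟨u q⟩`
reduce to nondegenerate forms over the residue field, and the theorem follows from Springer's
description of the form over `K` by these residue forms:

* isometries of residue forms of unit forms lift (`diagonalForm_equivalent_of_residue`), by a
  Gram–Schmidt process that uses that every element of `1 + 𝔪` is a square; in particular
  isotropy and hyperbolicity lift;
* if all residue forms are anisotropic, so is `⊥_q c q ⟨u q⟩` (`anisotropic_sigma_of_residue`),
  since nonzero values of the summands have pairwise distinct valuations.

Given an anisotropic torsion form of dimension `d` over the residue field, lift it to `⟨u⟩`; for any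
finite set of `N` classes, `⊥_q c q ⟨u⟩` is an anisotropic torsion form of dimension `N d`
(`card_mul_le_generalUInvariant`). Conversely, let `⊥_q c q ⟨u q⟩` be anisotropic with hyperbolic
`m`-fold multiple. The residue forms are anisotropic since isotropy lifts. Lifting the Witt
decompositions of the `m`-fold multiples of the residue forms exhibits the `m`-fold multiple of
`⊥_q c q ⟨u q⟩` as a sum of hyperbolic planes and of a form that is anisotropic by Springer. The
latter vanishes by a dimension count of totally isotropic subspaces
(`finrank_eq_zero_of_equivalent_pi_hyperbolicPlane`), so the residue forms are torsion and each of
them has dimension at most `u(Kv)` (`le_mul_generalUInvariant`).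
-/

noncomputable section

open QuadraticMap IsLocalRing

/-! ### Diagonal forms and their isometries -/

section DiagonalForms

variable {F : Type*} [Field F] {ι κ : Type*} [Fintype ι] [Fintype κ]

/-- The diagonal quadratic form `⟨w i⟩_i` on `ι → F`. -/
abbrev diagonalForm (w : ι → F) : QuadraticForm F (ι → F) := weightedSumSquares F w

lemma diagonalForm_apply (w x : ι → F) : diagonalForm w x = ∑ i, w i * (x i * x i) := by
  simp [diagonalForm, weightedSumSquares_apply]

lemma diagonalForm_equivalent_of_equiv (e : ι ≃ κ) {w : ι → F} {w' : κ → F}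
    (h : ∀ i, w' (e i) = w i) : (diagonalForm w).Equivalent (diagonalForm w') := by
  refine ⟨⟨LinearEquiv.funCongrLeft F F e.symm, fun x => ?_⟩⟩
  simp only [AddHom.toFun_eq_coe, LinearMap.coe_toAddHom, LinearEquiv.coe_coe,
    diagonalForm_apply, LinearEquiv.funCongrLeft_apply, LinearMap.funLeft_apply]
  rw [← e.sum_comp]
  simp [h]

lemma diagonalForm_equivalent_of_mul_sq {w w' s : ι → F} (hs : ∀ i, s i ≠ 0)
    (h : ∀ i, w i = w' i * s i ^ 2) : (diagonalForm w).Equivalent (diagonalForm w') := by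
  refine ⟨⟨LinearEquiv.piCongrRight fun i => LinearEquiv.smulOfNeZero F F (s i) (hs i),
    fun x => ?_⟩⟩
  simp only [AddHom.toFun_eq_coe, LinearMap.coe_toAddHom, LinearEquiv.coe_coe,
    diagonalForm_apply, LinearEquiv.piCongrRight_apply, LinearEquiv.smulOfNeZero_apply, smul_eq_mul]
  refine Finset.sum_congr rfl fun i _ => ?_
  rw [h]; ring

lemma diagonalForm_mul_equivalent {w : ι → F} {w' : κ → F}
    (h : (diagonalForm w).Equivalent (diagonalForm w')) (c : F) :
    (diagonalForm fun i => c * w i).Equivalent (diagonalForm fun i => c * w' i) := by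
  obtain ⟨f⟩ := h
  refine ⟨⟨f.toLinearEquiv, fun x => ?_⟩⟩
  have := f.map_app x
  simp only [diagonalForm_apply, mul_assoc, ← Finset.mul_sum] at this ⊢
  exact congrArg (c * ·) this

lemma diagonalForm_sum_equivalent (a : ι → F) (b : κ → F) :
    (diagonalForm (Sum.elim a b)).Equivalent ((diagonalForm a).prod (diagonalForm b)) := by
  refine ⟨⟨LinearEquiv.sumArrowLequivProdArrow ι κ F F, fun x => ?_⟩⟩
  simp only [AddHom.toFun_eq_coe, LinearMap.coe_toAddHom, LinearEquiv.coe_coe, prod_apply,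
    diagonalForm_apply, Fintype.sum_sum_type]
  rfl

lemma diagonalForm_sum_congr {ι' κ' : Type*} [Fintype ι'] [Fintype κ'] {a : ι → F} {b : κ → F}
    {a' : ι' → F} {b' : κ' → F} (ha : (diagonalForm a).Equivalent (diagonalForm a'))
    (hb : (diagonalForm b).Equivalent (diagonalForm b')) :
    (diagonalForm (Sum.elim a b)).Equivalent (diagonalForm (Sum.elim a' b')) :=
  (diagonalForm_sum_equivalent a b).trans
    ((Equivalent.prod ha hb).trans (diagonalForm_sum_equivalent a' b').symm)

lemma diagonalForm_sigma_equivalent {κ : ι → Type*} [∀ i, Fintype (κ i)] (w : ∀ i, κ i → F) :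
    (diagonalForm fun p : Σ i, κ i => w p.1 p.2).Equivalent
      (QuadraticMap.pi fun i => diagonalForm (w i)) := by
  refine ⟨⟨LinearEquiv.piCurry F fun _ _ => F, fun x => ?_⟩⟩
  simp only [AddHom.toFun_eq_coe, LinearMap.coe_toAddHom, LinearEquiv.coe_coe, pi_apply,
    diagonalForm_apply, Fintype.sum_sigma]
  rfl

lemma diagonalForm_sigma_congr {κ κ' : ι → Type*} [∀ i, Fintype (κ i)] [∀ i, Fintype (κ' i)]
    {w : ∀ i, κ i → F} {w' : ∀ i, κ' i → F}
    (h : ∀ i, (diagonalForm (w i)).Equivalent (diagonalForm (w' i))) :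
    (diagonalForm fun p : Σ i, κ i => w p.1 p.2).Equivalent
      (diagonalForm fun p : Σ i, κ' i => w' p.1 p.2) :=
  (diagonalForm_sigma_equivalent w).trans
    ((Equivalent.pi h).trans (diagonalForm_sigma_equivalent w').symm)

lemma QuadraticForm.multiple_equivalent_diagonalForm {V : Type*} [AddCommGroup V] [Module F V]
    {φ : QuadraticForm F V} {w : ι → F} (h : φ.Equivalent (diagonalForm w)) (m : ℕ) :
    (φ.multiple m).Equivalent (diagonalForm fun p : Fin m × ι => w p.2) :=
  (Equivalent.pi fun _ => h).trans ((diagonalForm_sigma_equivalent fun _ : Fin m => w).symm.trans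
    (diagonalForm_equivalent_of_equiv (Equiv.sigmaEquivProd _ _) fun _ => rfl))

/-- The weights of the diagonal form `⊥_k ⟨c k, -c k⟩`, a sum of hyperbolic planes. -/
def hyperbolicWeights {R κ : Type*} [Neg R] (c : κ → R) : κ × Bool → R :=
  fun p => if p.2 then c p.1 else -c p.1

lemma mul_hyperbolicWeights {κ : Type*} (a : F) (c : κ → F) (p : κ × Bool) :
    a * hyperbolicWeights c p = hyperbolicWeights (fun k => a * c k) p := by
  unfold hyperbolicWeights
  split_ifs <;> ring

lemma hyperbolicWeights_equivalent (h2 : (2 : F) ≠ 0) {c : κ → F} (hc : ∀ k, c k ≠ 0) :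
    (diagonalForm (hyperbolicWeights c)).Equivalent
      (QuadraticMap.pi fun _ : κ => hyperbolicPlane F) := by
  -- `c x² - c y² = (c (x + y)) (x - y)`
  let f : (κ × Bool → F) ≃ₗ[F] (κ → F × F) :=
    { toFun := fun x k => (c k * (x (k, true) + x (k, false)), x (k, true) - x (k, false))
      invFun := fun y p => if p.2 then ((c p.1)⁻¹ * (y p.1).1 + (y p.1).2) / 2
        else ((c p.1)⁻¹ * (y p.1).1 - (y p.1).2) / 2
      map_add' := fun x y => by
        ext k <;> simp <;> ring
      map_smul' := fun a x => by
        ext k <;> simp <;> ring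
      left_inv := fun x => by
        ext ⟨k, b⟩
        have := hc k
        cases b <;> simp <;> field_simp <;> ring
      right_inv := fun y => by
        ext k
        all_goals
          have := hc k
          simp
          field_simp
          ring }
  refine ⟨⟨f, fun x => ?_⟩⟩
  simp only [pi_apply, diagonalForm_apply, Fintype.sum_prod_type, Fintype.sum_bool, hyperbolicPlane,
    linMulLin_apply, LinearMap.fst_apply, LinearMap.snd_apply, f, hyperbolicWeights]
  refine Finset.sum_congr rfl fun k _ => ?_
  simp
  ring

lemma pi_hyperbolicPlane_equivalent {n : ℕ} (h : Fintype.card κ = n) :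
    (QuadraticMap.pi fun _ : κ => hyperbolicPlane F).Equivalent
      ((hyperbolicPlane F).multiple n) := by
  let e := Fintype.equivFinOfCardEq h
  refine ⟨⟨LinearEquiv.funCongrLeft F (F × F) e.symm, fun x => ?_⟩⟩
  simp only [AddHom.toFun_eq_coe, LinearMap.coe_toAddHom, LinearEquiv.coe_coe,
    QuadraticForm.multiple, pi_apply, LinearEquiv.funCongrLeft_apply, LinearMap.funLeft_apply]
  exact e.symm.sum_comp fun k => hyperbolicPlane F (x k)

lemma QuadraticForm.isHyperbolic_of_equivalent {V : Type*} [AddCommGroup V] [Module F V]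
    {φ : QuadraticForm F V} (h2 : (2 : F) ≠ 0) {c : κ → F} (hc : ∀ k, c k ≠ 0)
    (h : φ.Equivalent (diagonalForm (hyperbolicWeights c))) : φ.IsHyperbolic :=
  ⟨Fintype.card κ, h.trans ((hyperbolicWeights_equivalent h2 hc).trans
    (pi_hyperbolicPlane_equivalent rfl))⟩

lemma QuadraticMap.Equivalent.anisotropic {V W : Type*} [AddCommGroup V] [Module F V]
    [AddCommGroup W] [Module F W] {φ : QuadraticForm F V} {ψ : QuadraticForm F W}
    (h : φ.Equivalent ψ) (hφ : φ.Anisotropic) : ψ.Anisotropic := by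
  obtain ⟨f⟩ := h
  intro x hx
  have := hφ (f.symm x) (by rw [f.symm.map_app, hx])
  simpa using congrArg f this

lemma card_eq_of_diagonalForm_equivalent {w : ι → F} {w' : κ → F}
    (h : (diagonalForm w).Equivalent (diagonalForm w')) : Fintype.card ι = Fintype.card κ := by
  obtain ⟨f⟩ := h
  simpa using f.toLinearEquiv.finrank_eq

/-- The symmetric bilinear form attached to `diagonalForm w`. -/
def diagonalBilin (w : ι → F) : LinearMap.BilinForm F (ι → F) :=
  LinearMap.mk₂ F (fun x y => ∑ i, w i * (x i * y i))
    (fun x x' y => by simp [add_mul, mul_add, Finset.sum_add_distrib])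
    (fun a x y => by simp only [Pi.smul_apply, smul_eq_mul, Finset.mul_sum]; congr! 1; ring)
    (fun x y y' => by simp [mul_add, Finset.sum_add_distrib])
    (fun a x y => by simp only [Pi.smul_apply, smul_eq_mul, Finset.mul_sum]; congr! 1; ring)

lemma diagonalBilin_apply (w x y : ι → F) : diagonalBilin w x y = ∑ i, w i * (x i * y i) := rfl

lemma diagonalBilin_self (w x : ι → F) : diagonalBilin w x x = diagonalForm w x := by
  rw [diagonalForm_apply, diagonalBilin_apply]

lemma diagonalBilin_comm (w x y : ι → F) : diagonalBilin w x y = diagonalBilin w y x := by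
  simp [diagonalBilin_apply, mul_comm]

lemma diagonalForm_add (w x y : ι → F) : diagonalForm w (x + y) =
    diagonalForm w x + diagonalForm w y + 2 * diagonalBilin w x y := by
  simp only [← diagonalBilin_self, map_add, LinearMap.add_apply]
  rw [diagonalBilin_comm w y x]
  ring

lemma diagonalForm_single [DecidableEq ι] (w : ι → F) (i : ι) (a : F) :
    diagonalForm w (Pi.single i a) = w i * (a * a) := by
  rw [diagonalForm_apply, Finset.sum_eq_single i] <;> simp +contextual

lemma diagonalBilin_single [DecidableEq ι] (w x : ι → F) (i : ι) (a : F) :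
    diagonalBilin w x (Pi.single i a) = w i * (x i * a) := by
  rw [diagonalBilin_apply, Finset.sum_eq_single i] <;> simp +contextual

lemma diagonalBilin_map (h2 : (2 : F) ≠ 0) {w : ι → F} {w' : κ → F}
    (f : (diagonalForm w).IsometryEquiv (diagonalForm w')) (x y : ι → F) :
    diagonalBilin w' (f x) (f y) = diagonalBilin w x y := by
  have h := diagonalForm_add w' (f x) (f y)
  rw [← map_add, f.map_app, f.map_app, f.map_app, diagonalForm_add] at h
  exact (mul_left_cancel₀ h2 (add_left_cancel h)).symm

/-- Nondegeneracy is an isometry invariant: over a field of characteristic not two, a diagonal form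
isometric to one with nonzero entries has nonzero entries. -/
lemma ne_zero_of_diagonalForm_equivalent (h2 : (2 : F) ≠ 0) {w : ι → F} {w' : κ → F}
    (h : (diagonalForm w).Equivalent (diagonalForm w')) (hw : ∀ i, w i ≠ 0) (k : κ) :
    w' k ≠ 0 := by
  classical
  obtain ⟨f⟩ := h
  intro hk
  -- If `w' k = 0`, the `k`-th basis vector is orthogonal to the whole space.
  have hf : f.symm (Pi.single k 1) = 0 := by
    funext i
    have := diagonalBilin_map h2 f.symm (f (Pi.single i 1)) (Pi.single k 1)
    rw [diagonalBilin_single, hk, zero_mul, f.symm_apply_apply, diagonalBilin_comm,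
      diagonalBilin_single] at this
    simpa [hw i] using this
  have := congrFun (congrArg f hf) k
  simp at this

/-- A nonzero isotropic vector of a nondegenerate form makes the form universal. -/
lemma exists_diagonalForm_eq_of_not_anisotropic (h2 : (2 : F) ≠ 0) {w : ι → F}
    (hw : ∀ i, w i ≠ 0) (h : ¬ (diagonalForm w).Anisotropic) (a : F) :
    ∃ y, diagonalForm w y = a := by
  classical
  simp only [QuadraticMap.Anisotropic, not_forall] at h
  obtain ⟨x, hx, hx0⟩ := h
  obtain ⟨i, hi⟩ := Function.ne_iff.1 hx0
  have hi : x i ≠ 0 := hi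
  have hwi := hw i
  -- On the line `s • x + eᵢ` the form is the linear function `w i + 2 * w i * x i * s` of `s`.
  refine ⟨((a - w i) / (2 * (w i * x i))) • x + Pi.single i 1, ?_⟩
  rw [diagonalForm_add, QuadraticMap.map_smul, hx, diagonalForm_single, map_smul,
    LinearMap.smul_apply, diagonalBilin_single]
  simp only [smul_eq_mul]
  field_simp
  ring

/-- A vector `y` with `φ y ≠ 0` splits off as an orthogonal summand, since
`V = ⟨y⟩ ⊕ ⟨y⟩^⊥`. -/
lemma exists_equivalent_sum_of_apply_ne_zero (h2 : (2 : F) ≠ 0) (w y : ι → F)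
    (hy : diagonalForm w y ≠ 0) : ∃ (m : ℕ) (b : Fin m → F), (diagonalForm w).Equivalent
      (diagonalForm (Sum.elim (fun _ : Unit => diagonalForm w y) b)) := by
  have := invertibleOfNonzero h2
  have hy' : diagonalBilin w y y ≠ 0 := by rwa [diagonalBilin_self]
  have hc := LinearMap.BilinForm.isCompl_span_singleton_orthogonal hy'
  have hy0 : y ≠ 0 := by
    rintro rfl
    simp at hy
  set W := (diagonalBilin w).orthogonal (Submodule.span F {y}) with hW
  obtain ⟨b, ⟨g⟩⟩ := QuadraticForm.equivalent_weightedSumSquares ((diagonalForm w).comp W.subtype)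
  refine ⟨_, b, (Equivalent.trans (diagonalForm_sum_equivalent _ _) ?_).symm⟩
  refine ⟨⟨((LinearEquiv.funUnique Unit F F).trans
    (LinearEquiv.toSpanNonzeroSingleton F _ y hy0)).prodCongr g.toLinearEquiv.symm |>.trans
      (Submodule.prodEquivOfIsCompl _ _ hc), fun x => ?_⟩⟩
  have h1 : diagonalBilin w (x.1 () • y) (g.symm x.2 : W) = 0 :=
    (g.symm x.2).2 _ (Submodule.smul_mem _ _ (Submodule.mem_span_singleton_self y))
  have h3 : diagonalForm w (g.symm x.2 : W) = diagonalForm b x.2 := g.symm.map_app x.2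
  have h4 := diagonalForm_add w (x.1 () • y) (g.symm x.2 : W)
  rw [h1, h3, QuadraticMap.map_smul] at h4
  simp only [prod_apply]
  refine Eq.trans ?_ (h4.trans ?_)
  · rfl
  · rw [diagonalForm_apply (fun _ : Unit => diagonalForm w y)]
    simp [mul_comm]

end DiagonalForms

/-! ### Witt decomposition -/

section WittDecomposition

variable {F : Type*} [Field F] {ι κ : Type*} [Fintype ι] [Fintype κ]

/-- A nondegenerate isotropic form contains a hyperbolic plane: it represents `1`, and the
complement of a vector of value `1` still represents `-1`. -/
lemma exists_equivalent_sum_hyperbolic_of_not_anisotropic (h2 : (2 : F) ≠ 0) {w : ι → F}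
    (hw : ∀ i, w i ≠ 0) (h : ¬ (diagonalForm w).Anisotropic) :
    ∃ (m : ℕ) (b : Fin m → F), (diagonalForm w).Equivalent
      (diagonalForm (Sum.elim b (hyperbolicWeights fun _ : Unit => (1 : F)))) := by
  obtain ⟨y, hy⟩ := exists_diagonalForm_eq_of_not_anisotropic h2 hw h 1
  obtain ⟨m, b, hb⟩ := exists_equivalent_sum_of_apply_ne_zero h2 w y (by simp [hy])
  rw [hy] at hb
  have hb0 : ∀ i, b i ≠ 0 := fun i =>
    ne_zero_of_diagonalForm_equivalent h2 hb hw (Sum.inr i)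
  have hneg : ∃ z, diagonalForm b z = -1 := by
    by_cases hbi : (diagonalForm b).Anisotropic
    · -- An isotropic vector `(t, x')` of `⟨1⟩ ⊥ ⟨b⟩` has `t ≠ 0`, and `x' / t` has value `-1`.
      have hiso := mt hb.symm.anisotropic h
      simp only [QuadraticMap.Anisotropic, not_forall] at hiso
      obtain ⟨x, hx, hx0⟩ := hiso
      have hx' : x (Sum.inl ()) * x (Sum.inl ()) + diagonalForm b (fun i => x (Sum.inr i)) = 0 := by
        simpa [diagonalForm_apply] using hx
      have ht : x (Sum.inl ()) ≠ 0 := by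
        intro ht
        refine hx0 (funext fun i => ?_)
        rw [ht, zero_mul, zero_add] at hx'
        rcases i with i | i
        · exact ht
        · exact congrFun (hbi _ hx') i
      refine ⟨(x (Sum.inl ()))⁻¹ • fun i => x (Sum.inr i), ?_⟩
      rw [QuadraticMap.map_smul, eq_neg_of_add_eq_zero_right hx', smul_eq_mul]
      field_simp
    · exact exists_diagonalForm_eq_of_not_anisotropic h2 hb0 hbi _
  obtain ⟨z, hz⟩ := hneg
  obtain ⟨m', b', hb'⟩ := exists_equivalent_sum_of_apply_ne_zero h2 b z (by simp [hz])
  rw [hz] at hb'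
  refine ⟨m', b', hb.trans ((diagonalForm_sum_congr (Equivalent.refl _) hb').trans ?_)⟩
  let e : Unit ⊕ (Unit ⊕ Fin m') ≃ Fin m' ⊕ Unit × Bool :=
    { toFun := Sum.elim (fun _ => Sum.inr ((), true))
        (Sum.elim (fun _ => Sum.inr ((), false)) Sum.inl)
      invFun := Sum.elim (fun i => Sum.inr (Sum.inr i))
        (fun p => if p.2 then Sum.inl () else Sum.inr (Sum.inl ()))
      left_inv := by rintro (_ | _ | _) <;> simp
      right_inv := by rintro (_ | ⟨_, _ | _⟩) <;> simp }
  exact diagonalForm_equivalent_of_equiv e (by rintro (_ | _ | _) <;> simp [e, hyperbolicWeights])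

/-- Existence of the Witt decomposition `⟨w⟩ ≅ ⟨b⟩ ⊥ k ⟨1, -1⟩` with `⟨b⟩` anisotropic. -/
lemma exists_witt_decomposition (h2 : (2 : F) ≠ 0) {w : ι → F} (hw : ∀ i, w i ≠ 0) :
    ∃ (l k : ℕ) (b : Fin l → F), (diagonalForm b).Anisotropic ∧ (diagonalForm w).Equivalent
      (diagonalForm (Sum.elim b (hyperbolicWeights fun _ : Fin k => (1 : F)))) := by
  suffices H : ∀ (n : ℕ) (w : Fin n → F), (∀ i, w i ≠ 0) →
      ∃ (l k : ℕ) (b : Fin l → F), (diagonalForm b).Anisotropic ∧ (diagonalForm w).Equivalent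
        (diagonalForm (Sum.elim b (hyperbolicWeights fun _ : Fin k => (1 : F)))) by
    let e := Fintype.equivFin ι
    obtain ⟨l, k, b, hb, hwb⟩ := H _ (w ∘ e.symm) fun i => hw _
    exact ⟨l, k, b, hb, (diagonalForm_equivalent_of_equiv e (by simp)).trans hwb⟩
  clear hw w
  intro n
  induction n using Nat.strong_induction_on with
  | _ n ih =>
  intro w hw
  by_cases h : (diagonalForm w).Anisotropic
  · refine ⟨n, 0, w, h, diagonalForm_equivalent_of_equiv (Equiv.sumEmpty _ _).symm ?_⟩
    simp
  · obtain ⟨m, b, hb⟩ := exists_equivalent_sum_hyperbolic_of_not_anisotropic h2 hw h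
    have hcard := card_eq_of_diagonalForm_equivalent hb
    simp only [Fintype.card_fin, Fintype.card_sum, Fintype.card_prod, Fintype.card_unit,
      Fintype.card_bool] at hcard
    obtain ⟨l, k, b', hb', hbb'⟩ := ih m (by omega) b fun i =>
      ne_zero_of_diagonalForm_equivalent h2 hb hw (Sum.inl i)
    refine ⟨l, k + 1, b', hb', hb.trans (
      (diagonalForm_sum_congr hbb' (Equivalent.refl _)).trans ?_)⟩
    let e : (Fin l ⊕ Fin k × Bool) ⊕ Unit × Bool ≃ Fin l ⊕ Fin (k + 1) × Bool :=
      (Equiv.sumAssoc _ _ _).trans ((Equiv.refl _).sumCongr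
        ((Equiv.sumProdDistrib _ _ _).symm.trans (Equiv.prodCongr
          (((Equiv.refl (Fin k)).sumCongr finOneEquiv.symm).trans finSumFinEquiv) (Equiv.refl _))))
    exact diagonalForm_equivalent_of_equiv e
      (by rintro ((_ | _) | _) <;> simp [e, hyperbolicWeights])

lemma diagonalBilin_one_nondegenerate :
    (diagonalBilin (fun _ : κ => (1 : F))).Nondegenerate := by
  classical
  refine LinearMap.IsRefl.nondegenerate_iff_separatingLeft ?_ |>.2 ?_
  · intro x y h
    rw [diagonalBilin_comm, h]
  · intro x hx
    funext k
    simpa [diagonalBilin_single] using hx (Pi.single k 1)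

/-- The anisotropic part of a hyperbolic form vanishes. If `W` is totally isotropic in
`A ⊥ ⊥_κ H`, with `H` having coordinates `(x, y)`, then the kernel of `y : W → F^κ` lies in the
`x`-coordinate space because `A` is anisotropic, and it is orthogonal to the image of `y`; hence
`dim W ≤ |κ|`. -/
lemma finrank_eq_zero_of_equivalent_pi_hyperbolicPlane {A : Type*} [AddCommGroup A] [Module F A]
    [FiniteDimensional F A] {α : QuadraticForm F A} (hα : α.Anisotropic)
    (h : (α.prod (QuadraticMap.pi fun _ : κ => hyperbolicPlane F)).Equivalent
      (QuadraticMap.pi fun _ : ι => hyperbolicPlane F)) : Module.finrank F A = 0 := by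
  obtain ⟨f⟩ := h.symm
  -- The map `l` parametrizes a totally isotropic subspace, with hyperbolic coordinates `p`, `g`.
  let l : (ι → F) →ₗ[F] A × (κ → F × F) := f.toLinearEquiv.toLinearMap ∘ₗ
    LinearMap.pi fun i => LinearMap.inl F F F ∘ₗ LinearMap.proj i
  have hl0 : ∀ x, l x = 0 → x = 0 := by
    intro x hx
    have := f.toLinearEquiv.map_eq_zero_iff.1 hx
    funext i
    exact congrArg Prod.fst (congrFun this i)
  let g : (ι → F) →ₗ[F] (κ → F) :=
    LinearMap.pi fun k => LinearMap.snd F F F ∘ₗ LinearMap.proj k ∘ₗ LinearMap.snd F A _ ∘ₗ l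
  let p : (ι → F) →ₗ[F] (κ → F) :=
    LinearMap.pi fun k => LinearMap.fst F F F ∘ₗ LinearMap.proj k ∘ₗ LinearMap.snd F A _ ∘ₗ l
  have hq : ∀ x, α (l x).1 + ∑ k, p x k * g x k = 0 := by
    intro x
    have := f.map_app fun i => (x i, (0 : F))
    simp only [prod_apply, pi_apply, hyperbolicPlane, linMulLin_apply, LinearMap.fst_apply,
      LinearMap.snd_apply, mul_zero, Finset.sum_const_zero] at this
    exact this
  have hker : ∀ x, g x = 0 → (l x).1 = 0 := by
    intro x hx
    have := hq x
    simp only [hx, Pi.zero_apply, mul_zero, Finset.sum_const_zero, add_zero] at this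
    exact hα _ this
  have horth : ∀ x, g x = 0 → ∀ y, ∑ k, p x k * g y k = 0 := by
    intro x hx y
    have h1 := hq (x + y)
    simp only [map_add, Prod.fst_add, hker x hx, hx, zero_add, Pi.add_apply, Pi.zero_apply, add_mul,
      Finset.sum_add_distrib] at h1
    linear_combination h1 - hq y
  let r := p ∘ₗ (LinearMap.ker g).subtype
  have hr : Function.Injective r := by
    rw [← LinearMap.ker_eq_bot, LinearMap.ker_eq_bot']
    intro x hx
    have hgx : g x = 0 := x.2
    refine Subtype.ext (hl0 _ (Prod.ext (hker _ hgx) (funext fun k => Prod.ext ?_ ?_)))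
    · exact congrFun hx k
    · exact congrFun hgx k
  have hle : LinearMap.range g ≤
      (diagonalBilin (fun _ : κ => (1 : F))).orthogonal (LinearMap.range r) := by
    rintro _ ⟨y, rfl⟩ _ ⟨x, rfl⟩
    have := horth x x.2 y
    rw [diagonalBilin_apply]
    simp only [one_mul]
    exact this
  have h1 := Submodule.finrank_mono hle
  rw [LinearMap.BilinForm.finrank_orthogonal diagonalBilin_one_nondegenerate,
    LinearMap.finrank_range_of_inj hr, Module.finrank_fintype_fun_eq_card] at h1
  have h2 := LinearMap.finrank_range_add_finrank_ker g
  rw [Module.finrank_fintype_fun_eq_card] at h2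
  have h4 := (LinearMap.range r).finrank_le
  rw [LinearMap.finrank_range_of_inj hr, Module.finrank_fintype_fun_eq_card] at h4
  have h5 := f.toLinearEquiv.finrank_eq
  simp only [Module.finrank_prod, Module.finrank_pi_fintype, Module.finrank_self,
    Finset.sum_const, Finset.card_univ, smul_eq_mul] at h5
  omega

lemma isEmpty_of_isHyperbolic_sum (h2 : (2 : F) ≠ 0) {a : ι → F} (ha : (diagonalForm a).Anisotropic)
    {c : κ → F} (hc : ∀ k, c k ≠ 0)
    (h : (diagonalForm (Sum.elim a (hyperbolicWeights c))).IsHyperbolic) : IsEmpty ι := by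
  obtain ⟨n, hn⟩ := h
  have hprod := (Equivalent.prod (Equivalent.refl (diagonalForm a))
    (hyperbolicWeights_equivalent h2 hc).symm).trans (diagonalForm_sum_equivalent _ _).symm
  have := finrank_eq_zero_of_equivalent_pi_hyperbolicPlane ha (hprod.trans hn)
  rw [Module.finrank_fintype_fun_eq_card] at this
  exact Fintype.card_eq_zero_iff.1 this

end WittDecomposition

/-! ### Residue forms and Springer's theorem -/

section Valuation

variable {K : Type*} [Field K] {Γ₀ : Type*} [LinearOrderedCommGroupWithZero Γ₀]
  (v : Valuation K Γ₀)

lemma Valuation.residue_eq_zero_iff (x : v.valuationSubring) :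
    residue v.valuationSubring x = 0 ↔ v x < 1 := by
  rw [IsLocalRing.residue_eq_zero_iff, IsLocalRing.mem_maximalIdeal, mem_nonunits_iff,
    ← not_le, not_iff_not]
  constructor
  · intro h
    obtain ⟨y, hy⟩ := isUnit_iff_exists_inv.1 h
    have h1 : v x * v y = 1 := by
      rw [← map_mul]
      simpa using congrArg (fun z : v.valuationSubring => v z) hy
    have h2 : v y ≤ 1 := y.2
    calc (1 : Γ₀) = v x * v y := h1.symm
      _ ≤ v x * 1 := mul_le_mul_right h2 _
      _ = v x := mul_one _
  · intro h
    have hx : (x : K) ≠ 0 := by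
      intro h0
      simp [h0] at h
    refine isUnit_iff_exists_inv.2 ⟨⟨(x : K)⁻¹, ?_⟩, Subtype.ext (mul_inv_cancel₀ hx)⟩
    rw [Valuation.mem_valuationSubring_iff, map_inv₀]
    exact inv_le_one_of_one_le₀ h

lemma Valuation.residue_ne_zero_iff (x : v.valuationSubring) :
    residue v.valuationSubring x ≠ 0 ↔ v x = 1 := by
  rw [Ne, v.residue_eq_zero_iff, not_lt]
  exact ⟨fun h => le_antisymm x.2 h, fun h => h.ge⟩

/-- Gram–Schmidt with perturbation: a family whose Gram matrix is congruent to `diag(b)` modulo the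
maximal ideal can be modified, within its span, to have Gram matrix exactly `diag(b)`. The
hypothesis on squares adjusts the lengths. -/
lemma exists_orthogonal_of_approx
    (hsq : ∀ x : K, v x < 1 → ∃ y : Kˣ, 1 + x = (y : K) ^ 2)
    {V : Type*} [AddCommGroup V] [Module K V] (B : LinearMap.BilinForm K V)
    (hB : ∀ x y, B x y = B y x) {n : ℕ} (e : Fin n → V) (b : Fin n → K)
    (hb : ∀ i, v (b i) = 1) (hd : ∀ i, v (B (e i) (e i) - b i) < 1)
    (ho : ∀ i j, i ≠ j → v (B (e i) (e j)) < 1) :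
    ∃ f : Fin n → V, (∀ i, B (f i) (f i) = b i) ∧ (∀ i j, i ≠ j → B (f i) (f j) = 0) ∧
      ∀ z, (∀ i, B z (e i) = 0) → ∀ i, B z (f i) = 0 := by
  induction n with
  | zero => exact ⟨e, fun i => i.elim0, fun i => i.elim0, fun _ _ i => i.elim0⟩
  | succ n ih =>
    have hb0 : b 0 ≠ 0 := by
      intro h
      simpa [h] using hb 0
    obtain ⟨y, hy⟩ := hsq ((B (e 0) (e 0) - b 0) / b 0) (by
      rw [map_div₀, hb, div_one]; exact hd 0)
    have hy' : B (e 0) (e 0) = b 0 * (y : K) ^ 2 := by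
      rw [← hy]; field_simp; ring
    have hy0 : (y : K) ≠ 0 := y.ne_zero
    have hB0 : B (e 0) (e 0) ≠ 0 := by
      rw [hy']; exact mul_ne_zero hb0 (pow_ne_zero _ hy0)
    have hv0 : v (B (e 0) (e 0)) = 1 := by
      have := v.map_add_eq_of_lt_right (x := B (e 0) (e 0) - b 0) (y := b 0)
        (by rw [hb]; exact hd 0)
      simpa [hb] using this
    -- Subtracting the projections to `e 0` changes the remaining Gram matrix only by elements of
    -- the maximal ideal, so the induction hypothesis applies to `g`.
    let g : Fin n → V := fun i => e i.succ - (B (e 0) (e i.succ) / B (e 0) (e 0)) • e 0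
    have hg : ∀ i j, B (g i) (g j) = B (e i.succ) (e j.succ) -
        B (e 0) (e i.succ) * B (e 0) (e j.succ) / B (e 0) (e 0) := by
      intro i j
      simp only [g, map_sub, map_smul, LinearMap.sub_apply, LinearMap.smul_apply, smul_eq_mul]
      rw [hB (e i.succ) (e 0)]
      field_simp
      ring
    have hg0 : ∀ j, B (e 0) (g j) = 0 := by
      intro j
      simp only [g, map_sub, map_smul, smul_eq_mul]
      field_simp
      ring
    have hsmall : ∀ i j : Fin n,
        v (B (e 0) (e i.succ) * B (e 0) (e j.succ) / B (e 0) (e 0)) < 1 := by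
      intro i j
      rw [map_div₀, hv0, div_one, map_mul]
      exact mul_lt_one_of_lt_of_le (ho 0 i.succ (Fin.succ_ne_zero i).symm)
        (ho 0 j.succ (Fin.succ_ne_zero j).symm).le
    obtain ⟨f, hfd, hfo, hfs⟩ := ih g (fun i => b i.succ) (fun i => hb _)
      (fun i => by
        rw [hg, sub_right_comm]
        exact v.map_sub_lt (hd _) (hsmall i i))
      (fun i j hij => by
        rw [hg]
        exact v.map_sub_lt (ho _ _ (by simpa using hij)) (hsmall i j))
    have hf0 : ∀ j, B (e 0) (f j) = 0 := hfs _ hg0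
    -- The factor `y⁻¹` corrects the length `b 0 * y ^ 2` of `e 0`.
    refine ⟨Fin.cons ((y : K)⁻¹ • e 0) f, ?_, ?_, ?_⟩
    · intro i
      refine Fin.cases ?_ (fun i => ?_) i
      · simp only [Fin.cons_zero, map_smul, LinearMap.smul_apply, smul_eq_mul, hy']
        field_simp
      · simpa using hfd i
    · intro i j
      refine Fin.cases ?_ (fun i => ?_) i <;> refine Fin.cases ?_ (fun j => ?_) j
      · simp
      · simp [hf0]
      · simp [hB (f i), hf0]
      · intro hij
        simpa using hfo i j (by simpa using hij)
    · intro z hz i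
      refine Fin.cases ?_ (fun i => ?_) i
      · simp [hz]
      · simp only [Fin.cons_succ]
        exact hfs z (fun j => by simp [g, hz]) i

/-- Isometries between residue forms of unit diagonal forms lift: lift the images of the standard
basis vectors coordinatewise and correct the lifts by `exists_orthogonal_of_approx`. -/
lemma diagonalForm_equivalent_of_residue
    (hsq : ∀ x : K, v x < 1 → ∃ y : Kˣ, 1 + x = (y : K) ^ 2)
    (h2 : (2 : ResidueField v.valuationSubring) ≠ 0) {ι κ : Type*} [Fintype ι] [Fintype κ]
    {u : ι → v.valuationSubring} {b : κ → v.valuationSubring}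
    (hb : ∀ k, residue v.valuationSubring (b k) ≠ 0)
    (h : (diagonalForm fun i => residue v.valuationSubring (u i)).Equivalent
      (diagonalForm fun k => residue v.valuationSubring (b k))) :
    (diagonalForm fun i => (u i : K)).Equivalent (diagonalForm fun k => (b k : K)) := by
  classical
  suffices H : ∀ (n : ℕ) (b : Fin n → v.valuationSubring),
      (∀ k, residue v.valuationSubring (b k) ≠ 0) →
      (diagonalForm fun i => residue v.valuationSubring (u i)).Equivalent
        (diagonalForm fun k => residue v.valuationSubring (b k)) →
      (diagonalForm fun i => (u i : K)).Equivalent (diagonalForm fun k => (b k : K)) by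
    let e := Fintype.equivFin κ
    exact (H _ (b ∘ e.symm) (fun k => hb _)
      (h.trans (diagonalForm_equivalent_of_equiv e (by simp)))).trans
      (diagonalForm_equivalent_of_equiv e.symm (by simp))
  intro n b hb h
  have hcard := card_eq_of_diagonalForm_equivalent h
  obtain ⟨g⟩ := h.symm
  choose E hE using fun k i => residue_surjective (R := v.valuationSubring) (g (Pi.single k 1) i)
  set B := diagonalBilin fun i => (u i : K) with hBdef
  have hB : ∀ x y, B x y = B y x := diagonalBilin_comm _
  let c : Fin n → Fin n → v.valuationSubring := fun j k => ∑ i, u i * (E j i * E k i)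
  have hBc : ∀ j k, B (fun i => (E j i : K)) (fun i => (E k i : K)) = c j k := by
    intro j k
    simp [hBdef, diagonalBilin_apply, c]
  have hc : ∀ j k, residue v.valuationSubring (c j k) =
      residue v.valuationSubring (b k) * (Pi.single j 1 : Fin n → _) k := by
    intro j k
    have := diagonalBilin_map h2 g (Pi.single j 1) (Pi.single k 1)
    rw [diagonalBilin_single, mul_one] at this
    rw [← this]
    simp [diagonalBilin_apply, c, hE]
  obtain ⟨f, hfd, hfo, -⟩ := exists_orthogonal_of_approx v hsq B hB
    (fun k i => (E k i : K)) (fun k => (b k : K)) (fun k => (v.residue_ne_zero_iff _).1 (hb k))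
    (fun k => by
      rw [hBc]
      refine (v.residue_eq_zero_iff (c k k - b k)).1 ?_
      simp [hc])
    (fun j k hjk => by
      rw [hBc]
      refine (v.residue_eq_zero_iff (c j k)).1 ?_
      simp [hc, hjk.symm])
  have hb0 : ∀ k, (b k : K) ≠ 0 := by
    intro k h0
    have := (v.residue_ne_zero_iff _).1 (hb k)
    simp [h0] at this
  let T := Fintype.linearCombination K f
  have hT : ∀ x k, B (T x) (f k) = b k * x k := by
    intro x k
    rw [show T x = ∑ j, x j • f j from Fintype.linearCombination_apply K f x]
    simp only [map_sum, map_smul, LinearMap.sum_apply, LinearMap.smul_apply, smul_eq_mul]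
    rw [Finset.sum_eq_single k, hfd, mul_comm]
    · intro j _ hjk
      rw [hfo j k hjk, mul_zero]
    · simp
  have hTinj : Function.Injective T := by
    rw [← LinearMap.ker_eq_bot, LinearMap.ker_eq_bot']
    intro x hx
    funext k
    have := hT x k
    rw [hx, map_zero, LinearMap.zero_apply, zero_eq_mul] at this
    exact this.resolve_left (hb0 k)
  refine Equivalent.symm ⟨⟨LinearEquiv.ofInjectiveOfFinrankEq T hTinj (by simp [hcard]),
    fun x => ?_⟩⟩
  change diagonalForm _ (T x) = _
  rw [← diagonalBilin_self, ← hBdef]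
  nth_rewrite 2 [show T x = ∑ j, x j • f j from Fintype.linearCombination_apply K f x]
  simp only [map_sum, map_smul, smul_eq_mul, hT, diagonalForm_apply]
  exact Finset.sum_congr rfl fun k _ => by ring

lemma Valuation.exists_lift_weights {κ : Type*} (b : κ → ResidueField v.valuationSubring) :
    ∃ c : κ → v.valuationSubring, ∀ k, residue v.valuationSubring (c k) = b k := by
  choose c hc using fun k => residue_surjective (R := v.valuationSubring) (b k)
  exact ⟨c, hc⟩

lemma residue_hyperbolicWeights {κ : Type*} (c : κ → v.valuationSubring) (p : κ × Bool) :
    residue v.valuationSubring (hyperbolicWeights c p) =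
      hyperbolicWeights (fun k => residue v.valuationSubring (c k)) p := by
  unfold hyperbolicWeights
  split_ifs <;> simp

lemma coe_hyperbolicWeights {κ : Type*} (c : κ → v.valuationSubring) (p : κ × Bool) :
    ((hyperbolicWeights c p : v.valuationSubring) : K) =
      hyperbolicWeights (fun k => (c k : K)) p := by
  unfold hyperbolicWeights
  split_ifs <;> simp

/-- Witt-type decompositions of the residue form of a unit diagonal form lift. -/
lemma diagonalForm_equivalent_sum_hyperbolic_of_residue
    (hsq : ∀ x : K, v x < 1 → ∃ y : Kˣ, 1 + x = (y : K) ^ 2)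
    (h2 : (2 : ResidueField v.valuationSubring) ≠ 0) {ι κ κ' : Type*}
    [Fintype ι] [Fintype κ] [Fintype κ'] {u : ι → v.valuationSubring}
    (hu : ∀ i, residue v.valuationSubring (u i) ≠ 0) {b : κ → v.valuationSubring}
    (h : (diagonalForm fun i => residue v.valuationSubring (u i)).Equivalent
      (diagonalForm (Sum.elim (fun k => residue v.valuationSubring (b k))
        (hyperbolicWeights fun _ : κ' => 1)))) :
    (diagonalForm fun i => (u i : K)).Equivalent
      (diagonalForm (Sum.elim (fun k => (b k : K)) (hyperbolicWeights fun _ : κ' => 1))) := by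
  have hres : (fun p => residue v.valuationSubring
      (Sum.elim b (hyperbolicWeights fun _ : κ' => 1) p)) =
      Sum.elim (fun k => residue v.valuationSubring (b k)) (hyperbolicWeights fun _ : κ' => 1) := by
    funext p
    rcases p with k | p
    · rfl
    · simp [residue_hyperbolicWeights]
  have hcoe : (fun p => ((Sum.elim b (hyperbolicWeights fun _ : κ' => 1) p : v.valuationSubring)
      : K)) = Sum.elim (fun k => (b k : K)) (hyperbolicWeights fun _ : κ' => 1) := by
    funext p
    rcases p with k | p
    · rfl
    · simp [coe_hyperbolicWeights]
  rw [← hcoe]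
  rw [← hres] at h
  exact diagonalForm_equivalent_of_residue v hsq h2
    (ne_zero_of_diagonalForm_equivalent h2 h hu) h

/-- Isotropy of the residue form of a unit diagonal form lifts, because a hyperbolic plane does. -/
lemma anisotropic_residue (hsq : ∀ x : K, v x < 1 → ∃ y : Kˣ, 1 + x = (y : K) ^ 2)
    (h2 : (2 : ResidueField v.valuationSubring) ≠ 0) {ι : Type*} [Fintype ι]
    {u : ι → v.valuationSubring} (hu : ∀ i, residue v.valuationSubring (u i) ≠ 0)
    (h : (diagonalForm fun i => (u i : K)).Anisotropic) :
    (diagonalForm fun i => residue v.valuationSubring (u i)).Anisotropic := by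
  by_contra hiso
  obtain ⟨m, b, hb⟩ := exists_equivalent_sum_hyperbolic_of_not_anisotropic h2 hu hiso
  obtain ⟨c, hc⟩ := v.exists_lift_weights b
  obtain rfl : (fun k => residue v.valuationSubring (c k)) = b := funext hc
  have := (diagonalForm_equivalent_sum_hyperbolic_of_residue v hsq h2 hu hb).anisotropic h
  have h0 := congrFun (this (Sum.elim 0 1) (by
    simp [hyperbolicWeights, Fintype.sum_prod_type])) (Sum.inr ((), true))
  simp at h0

/-- If the residue form of `⟨u⟩` is anisotropic, then the values of `⟨u⟩` at nonzero vectors have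
valuation in `2 vK`, namely twice the minimum of the valuations of the coordinates. -/
lemma exists_valuation_diagonalForm_eq_sq {ι : Type*} [Fintype ι] {u : ι → v.valuationSubring}
    (h : (diagonalForm fun i => residue v.valuationSubring (u i)).Anisotropic) (x : ι → K) :
    ∃ t : K, v (diagonalForm (fun i => (u i : K)) x) = v t ^ 2 ∧ (t = 0 → x = 0) := by
  by_cases hx : x = 0
  · exact ⟨0, by simp [hx], fun _ => hx⟩
  obtain ⟨j, hj⟩ := Function.ne_iff.1 hx
  obtain ⟨i, -, hi⟩ := Finset.exists_max_image Finset.univ (fun i => v (x i))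
    ⟨j, Finset.mem_univ j⟩
  have hxi : x i ≠ 0 := by
    intro h0
    have := hi j (Finset.mem_univ j)
    simp only [h0, map_zero, le_zero_iff, map_eq_zero] at this
    exact hj this
  refine ⟨x i, ?_, fun h0 => absurd h0 hxi⟩
  have hvi : v (x i) ≠ 0 := (map_ne_zero v).2 hxi
  -- Dividing by a coordinate of largest valuation gives a primitive integral vector.
  let z : ι → v.valuationSubring := fun k => ⟨x k / x i, by
    rw [Valuation.mem_valuationSubring_iff, map_div₀]
    exact div_le_one_of_le₀ (hi k (Finset.mem_univ k)) zero_le⟩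
  have hz : residue v.valuationSubring (∑ k, u k * (z k * z k)) ≠ 0 := by
    intro h0
    have h1 := h (fun k => residue v.valuationSubring (z k))
      (by simpa [diagonalForm_apply] using h0)
    have h3 : z i = 1 := Subtype.ext (div_self hxi)
    have := congrFun h1 i
    simp [h3] at this
  have hval : diagonalForm (fun k => (u k : K)) x =
      x i ^ 2 * ((∑ k, u k * (z k * z k) : v.valuationSubring) : K) := by
    rw [diagonalForm_apply, AddSubmonoidClass.coe_finsetSum, Finset.mul_sum]
    refine Finset.sum_congr rfl fun k _ => ?_
    simp only [z, MulMemClass.coe_mul]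
    field_simp
  rw [hval, map_mul, map_pow, (v.residue_ne_zero_iff _).1 hz, mul_one]

/-- Springer: if the residue forms of the unit forms `⟨u q⟩` are anisotropic and the `c q` have
valuations in distinct classes of `vK/2vK`, then `⊥_q c q ⟨u q⟩` is anisotropic, because nonzero
terms of distinct valuations cannot cancel. -/
lemma anisotropic_sigma_of_residue {S : Type*} [Fintype S] {κ : S → Type*} [∀ q, Fintype (κ q)]
    {u : ∀ q, κ q → v.valuationSubring}
    (h : ∀ q, (diagonalForm fun k => residue v.valuationSubring (u q k)).Anisotropic)
    {c : S → K} (hc0 : ∀ q, c q ≠ 0)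
    (hc : ∀ q q' (t : K), t ≠ 0 → v (c q) = v (c q') * v t ^ 2 → q = q') :
    (diagonalForm fun p : Σ q, κ q => c p.1 * (u p.1 p.2 : K)).Anisotropic := by
  classical
  intro x hx
  choose t ht ht0 using fun q => exists_valuation_diagonalForm_eq_sq v (h q) fun k => x ⟨q, k⟩
  let f : S → K := fun q => c q * diagonalForm (fun k => (u q k : K)) fun k => x ⟨q, k⟩
  have hf : ∀ q, v (f q) = v (c q) * v (t q) ^ 2 := fun q => by rw [map_mul, ht]
  have hsum : ∑ q, f q = 0 := by
    rw [← hx, diagonalForm_apply, Fintype.sum_sigma]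
    simp [f, Finset.mul_sum, mul_assoc]
  by_contra hx0
  obtain ⟨⟨q₀, k₀⟩, hqk⟩ := Function.ne_iff.1 hx0
  have hq₀ : t q₀ ≠ 0 := fun h0 => hqk (congrFun (ht0 q₀ h0) k₀)
  obtain ⟨j, -, hj⟩ := Finset.exists_max_image Finset.univ (fun q => v (f q))
    ⟨q₀, Finset.mem_univ _⟩
  have hfj : v (f j) ≠ 0 := by
    refine ne_of_gt (lt_of_lt_of_le (zero_lt_iff.2 ?_) (hj q₀ (Finset.mem_univ _)))
    rw [hf]
    exact mul_ne_zero ((map_ne_zero v).2 (hc0 _)) (pow_ne_zero _ ((map_ne_zero v).2 hq₀))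
  have htj : v (t j) ≠ 0 := by
    intro h0
    simp [hf, h0] at hfj
  have := v.map_sum_eq_of_lt (s := Finset.univ) (f := f) (Finset.mem_univ j) (by
    intro q hq
    have hqj : q ≠ j := by simpa using hq
    refine lt_of_le_of_ne (hj q (Finset.mem_univ _)) fun heq => ?_
    have htq : v (t q) ≠ 0 := by
      intro h0
      rw [← heq] at hfj
      simp [hf, h0] at hfj
    refine hqj (hc q j (t j / t q) (div_ne_zero ((map_ne_zero v).1 htj) ((map_ne_zero v).1 htq)) ?_)
    rw [hf, hf] at heq
    rw [map_div₀, div_pow, ← mul_div_assoc, ← heq, mul_div_cancel_right₀ _ (pow_ne_zero _ htq)])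
  rw [hsum, map_zero] at this
  exact hfj this.symm

end Valuation

/-! ### Hyperbolic and torsion forms -/

section TorsionForms

variable {F : Type*} [Field F]

lemma ringChar_ne_two_of_two_ne_zero (h2 : (2 : F) ≠ 0) : ringChar F ≠ 2 := by
  intro h
  have := ringChar.Nat.cast_ringChar (R := F)
  rw [h] at this
  exact h2 (by exact_mod_cast this)

variable {V W : Type*} [AddCommGroup V] [Module F V] [AddCommGroup W] [Module F W]
  {φ : QuadraticForm F V} {ψ : QuadraticForm F W}

lemma QuadraticForm.IsHyperbolic.of_equivalent (hφ : φ.IsHyperbolic) (h : φ.Equivalent ψ) :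
    ψ.IsHyperbolic := by
  obtain ⟨m, hm⟩ := hφ
  exact ⟨m, h.symm.trans hm⟩

lemma QuadraticForm.IsTorsionForm.of_equivalent (hφ : φ.IsTorsionForm) (h : φ.Equivalent ψ) :
    ψ.IsTorsionForm :=
  hφ.imp_right fun ⟨m, hm, hh⟩ => ⟨m, hm, hh.of_equivalent (Equivalent.pi fun _ => h)⟩

variable {ι : Type*} [Fintype ι]

lemma isTorsionForm_diagonalForm_iff (h2 : (2 : F) ≠ 0) {w : ι → F} :
    (diagonalForm w).IsTorsionForm ↔
      ∃ m : ℕ, 0 < m ∧ (diagonalForm fun p : Fin m × ι => w p.2).IsHyperbolic := by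
  have key := QuadraticForm.multiple_equivalent_diagonalForm (Equivalent.refl (diagonalForm w))
  constructor
  · rintro (h | ⟨m, hm, h⟩)
    · exact absurd h (ringChar_ne_two_of_two_ne_zero h2)
    · exact ⟨m, hm, h.of_equivalent (key m)⟩
  · rintro ⟨m, hm, h⟩
    exact Or.inr ⟨m, hm, h.of_equivalent (key m).symm⟩

lemma exists_equivalent_hyperbolicWeights (h2 : (2 : F) ≠ 0) (hφ : φ.IsHyperbolic) :
    ∃ k : ℕ, φ.Equivalent (diagonalForm (hyperbolicWeights fun _ : Fin k => (1 : F))) := by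
  obtain ⟨k, hk⟩ := hφ
  exact ⟨k, hk.trans (hyperbolicWeights_equivalent h2 fun _ => one_ne_zero).symm⟩

lemma exists_diagonalForm_of_anisotropic (h2 : (2 : F) ≠ 0) {n : ℕ}
    {φ : QuadraticForm F (Fin n → F)} (hφ : φ.Anisotropic) :
    ∃ w : Fin n → F, (∀ i, w i ≠ 0) ∧ φ.Equivalent (diagonalForm w) := by
  have := invertibleOfNonzero h2
  obtain ⟨w, hw⟩ := QuadraticForm.equivalent_weightedSumSquares φ
  let e := finCongr (Module.finrank_fin_fun F (n := n))
  have hwe : φ.Equivalent (diagonalForm (w ∘ e.symm)) :=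
    hw.trans (diagonalForm_equivalent_of_equiv e (by simp))
  refine ⟨w ∘ e.symm, fun i hi => ?_, hwe⟩
  have := congrFun (hwe.anisotropic hφ (Pi.single i 1)
    (by rw [diagonalForm_single, hi, zero_mul])) i
  simp at this

lemma card_le_generalUInvariant {w : ι → F} (hw : (diagonalForm w).Anisotropic)
    (ht : (diagonalForm w).IsTorsionForm) : (Fintype.card ι : ℕ∞) ≤ generalUInvariant F := by
  have h := diagonalForm_equivalent_of_equiv (Fintype.equivFin ι)
    (w := w) (w' := w ∘ (Fintype.equivFin ι).symm) (by simp)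
  exact le_sSup ⟨_, _, h.anisotropic hw, ht.of_equivalent h, rfl⟩

lemma anisotropic_of_sigma {S : Type*} [Fintype S] {κ : S → Type*} [∀ q, Fintype (κ q)]
    {w : ∀ q, κ q → F} {c : S → F}
    (h : (diagonalForm fun p : Σ q, κ q => c p.1 * w p.1 p.2).Anisotropic) (q : S) :
    (diagonalForm (w q)).Anisotropic := by
  classical
  intro x hx
  have h1 := anisotropic_of_pi
    ((diagonalForm_sigma_equivalent fun q k => c q * w q k).anisotropic h) q
  refine h1 x ?_
  rw [diagonalForm_apply] at hx ⊢
  simp only [mul_assoc, ← Finset.mul_sum, hx, mul_zero]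

end TorsionForms

/-! ### Classes of the value group modulo squares -/

section ValueClass

variable {K : Type*} [Field K] {Γ₀ : Type*} [LinearOrderedCommGroupWithZero Γ₀]
  (v : Valuation K Γ₀)

/-- The quotient `vK / 2vK` of the value group. -/
abbrev ValueClass : Type _ :=
  MonoidWithZeroHom.valueGroup (.ofClass v : K →*₀ Γ₀) ⧸
    (powMonoidHom 2 : MonoidWithZeroHom.valueGroup (.ofClass v : K →*₀ Γ₀) →*
      MonoidWithZeroHom.valueGroup (.ofClass v : K →*₀ Γ₀)).range

/-- The class of `v a` in `vK / 2vK`. -/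
def valueClass (a : Kˣ) : ValueClass v :=
  QuotientGroup.mk ⟨Units.map (v : K →* Γ₀) a, MonoidWithZeroHom.mem_valueGroup _ ⟨a, rfl⟩⟩

lemma exists_map_eq_of_mem_valueGroup
    (g : MonoidWithZeroHom.valueGroup (.ofClass v : K →*₀ Γ₀)) :
    ∃ a : Kˣ, v a = (g : Γ₀ˣ) := by
  obtain ⟨g, hg⟩ := g
  have : (g : Γ₀) ∈ Units.val '' (MonoidWithZeroHom.valueGroup (.ofClass v : K →*₀ Γ₀) : Set Γ₀ˣ) :=
    ⟨g, hg, rfl⟩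
  rw [MonoidWithZeroHom.valueGroup_eq_range] at this
  obtain ⟨⟨a, ha⟩, -⟩ := this
  have ha' : v a = g := ha
  have ha0 : a ≠ 0 := by
    rintro rfl
    rw [map_zero] at ha'
    exact g.ne_zero ha'.symm
  exact ⟨Units.mk0 a ha0, ha'⟩

lemma valueClass_surjective : Function.Surjective (valueClass v) := by
  intro q
  obtain ⟨g, rfl⟩ := QuotientGroup.mk_surjective q
  obtain ⟨a, ha⟩ := exists_map_eq_of_mem_valueGroup v g
  exact ⟨a, congrArg QuotientGroup.mk (Subtype.ext (Units.ext ha))⟩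

lemma valueClass_eq_iff (a b : Kˣ) :
    valueClass v a = valueClass v b ↔ ∃ t : K, t ≠ 0 ∧ v a = v b * v t ^ 2 := by
  rw [eq_comm, valueClass, valueClass, QuotientGroup.eq]
  constructor
  · rintro ⟨g, hg⟩
    obtain ⟨t, ht⟩ := exists_map_eq_of_mem_valueGroup v g
    refine ⟨t, t.ne_zero, ?_⟩
    have h1 : ((g : Γ₀ˣ) : Γ₀) ^ 2 = (v b)⁻¹ * v a := by
      simpa using congrArg (fun x : MonoidWithZeroHom.valueGroup (.ofClass v : K →*₀ Γ₀) =>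
        ((x : Γ₀ˣ) : Γ₀)) hg
    rw [ht, h1, mul_inv_cancel_left₀ ((map_ne_zero v).2 b.ne_zero)]
  · rintro ⟨t, ht0, ht⟩
    refine ⟨⟨Units.map (v : K →* Γ₀) (Units.mk0 t ht0),
      MonoidWithZeroHom.mem_valueGroup _ ⟨t, rfl⟩⟩, ?_⟩
    exact eq_inv_mul_iff_mul_eq.2 (Subtype.ext (Units.ext ht.symm))

end ValueClass

/-! ### Comparison of the two `u`-invariants -/

section Main

variable {K : Type*} [Field K] {Γ₀ : Type*} [LinearOrderedCommGroupWithZero Γ₀]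
  (v : Valuation K Γ₀)

lemma two_ne_zero_of_residue (h2 : (2 : ResidueField v.valuationSubring) ≠ 0) : (2 : K) ≠ 0 := by
  intro h
  have h0 : (2 : v.valuationSubring) = 0 := Subtype.ext h
  apply h2
  rw [← map_ofNat (residue v.valuationSubring) 2, h0, map_zero]

/-- Witt decompositions of the residue forms of the unit forms `⟨u q⟩` lift and add up to a
decomposition of `⊥_q c q ⟨u q⟩`. -/
lemma diagonalForm_sigma_equivalent_of_residue
    (hsq : ∀ x : K, v x < 1 → ∃ y : Kˣ, 1 + x = (y : K) ^ 2)
    (h2 : (2 : ResidueField v.valuationSubring) ≠ 0) {S : Type*} [Fintype S] {ι κ κ' : S → Type*}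
    [∀ q, Fintype (ι q)] [∀ q, Fintype (κ q)] [∀ q, Fintype (κ' q)]
    {u : ∀ q, ι q → v.valuationSubring} (hu : ∀ q i, residue v.valuationSubring (u q i) ≠ 0)
    {b : ∀ q, κ q → v.valuationSubring}
    (h : ∀ q, (diagonalForm fun i => residue v.valuationSubring (u q i)).Equivalent
      (diagonalForm (Sum.elim (fun k => residue v.valuationSubring (b q k))
        (hyperbolicWeights fun _ : κ' q => 1)))) (c : S → K) :
    (diagonalForm fun p : Σ q, ι q => c p.1 * (u p.1 p.2 : K)).Equivalent
      (diagonalForm (Sum.elim (fun p : Σ q, κ q => c p.1 * (b p.1 p.2 : K))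
        (hyperbolicWeights fun p : Σ q, κ' q => c p.1))) := by
  refine (diagonalForm_sigma_congr fun q => diagonalForm_mul_equivalent
    (diagonalForm_equivalent_sum_hyperbolic_of_residue v hsq h2 (hu q) (h q)) (c q)).trans ?_
  refine diagonalForm_equivalent_of_equiv ((Equiv.sigmaSumDistrib _ _).trans
    ((Equiv.refl _).sumCongr (Equiv.sigmaProdDistrib _ _).symm)) ?_
  rintro ⟨q, k | p⟩
  · simp
  · simp [mul_hyperbolicWeights]
    simp [hyperbolicWeights]

lemma diagonalForm_prod_sigma_equivalent {F : Type*} [Field F] {S : Type*} [Fintype S]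
    {ι : S → Type*} [∀ q, Fintype (ι q)] (m : ℕ) (w : ∀ q, ι q → F) :
    (diagonalForm fun p : Fin m × Σ q, ι q => w p.2.1 p.2.2).Equivalent
      (diagonalForm fun p : Σ q, Fin m × ι q => w p.1 p.2.2) :=
  diagonalForm_equivalent_of_equiv ((Equiv.prodComm _ _).trans ((Equiv.sigmaProdDistrib _ _).trans
    (Equiv.sigmaCongrRight fun _ => Equiv.prodComm _ _))) fun _ => rfl

/-- An anisotropic torsion form of dimension `d` over the residue field lifts to a unit form whose
multiples by representatives of any finite set of classes of `vK/2vK` form an anisotropic torsion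
form. -/
lemma card_mul_le_generalUInvariant
    (hsq : ∀ x : K, v x < 1 → ∃ y : Kˣ, 1 + x = (y : K) ^ 2)
    (h2 : (2 : ResidueField v.valuationSubring) ≠ 0) (S : Finset (ValueClass v)) {d : ℕ}
    {ψ : QuadraticForm (ResidueField v.valuationSubring)
      (Fin d → ResidueField v.valuationSubring)}
    (hψ : ψ.Anisotropic) (ht : ψ.IsTorsionForm) :
    (S.card * d : ℕ∞) ≤ generalUInvariant K := by
  obtain ⟨w', hw', hψw⟩ := exists_diagonalForm_of_anisotropic h2 hψ
  obtain ⟨w, hw⟩ := v.exists_lift_weights w'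
  obtain rfl : (fun k => residue v.valuationSubring (w k)) = w' := funext hw
  obtain ⟨m, hm, hhyp⟩ := (isTorsionForm_diagonalForm_iff h2).1 (ht.of_equivalent hψw)
  obtain ⟨k, hk⟩ := exists_equivalent_hyperbolicWeights h2 hhyp
  choose c hc using fun q : S => valueClass_surjective v q.1
  have haniso : (diagonalForm fun p : Σ _ : S, Fin d =>
      (c p.1 : K) * (w p.2 : K)).Anisotropic := by
    refine anisotropic_sigma_of_residue v (u := fun _ => w)
      (fun _ => hψw.anisotropic hψ) (c := fun q => (c q : K)) (fun q => (c q).ne_zero) ?_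
    intro q q' t ht0 heq
    apply Subtype.ext
    rw [← hc q, ← hc q', valueClass_eq_iff]
    exact ⟨t, ht0, heq⟩
  have hk' : (diagonalForm fun p : Fin m × Fin d => residue v.valuationSubring (w p.2)).Equivalent
      (diagonalForm (Sum.elim (fun i : Fin 0 => residue v.valuationSubring (i.elim0))
        (hyperbolicWeights fun _ : Fin k => 1))) :=
    hk.trans (diagonalForm_equivalent_of_equiv (Equiv.emptySum (Fin 0) _).symm (by simp))
  have hsum := diagonalForm_sigma_equivalent_of_residue v hsq h2 (S := S)
    (ι := fun _ => Fin m × Fin d) (κ := fun _ => Fin 0)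
    (u := fun _ p => w p.2) (fun _ p => hw' p.2) (b := fun _ i => i.elim0) (fun _ => hk')
    (fun q => (c q : K))
  have htors : (diagonalForm fun p : Σ _ : S, Fin d =>
      (c p.1 : K) * (w p.2 : K)).IsTorsionForm := by
    have h2K := two_ne_zero_of_residue v h2
    refine (isTorsionForm_diagonalForm_iff h2K).2 ⟨m, hm, ?_⟩
    refine QuadraticForm.isHyperbolic_of_equivalent h2K
      (c := fun p : Σ _ : S, Fin k => (c p.1 : K)) (fun p => (c p.1).ne_zero) ?_
    refine (diagonalForm_prod_sigma_equivalent m fun (q : S) (i : Fin d) =>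
      (c q : K) * (w i : K)).trans (hsum.trans ?_)
    have : IsEmpty (Σ _ : S, Fin 0) := ⟨fun p => p.2.elim0⟩
    exact diagonalForm_equivalent_of_equiv (Equiv.emptySum _ _) (by
      rintro (⟨_, i⟩ | _)
      · exact i.elim0
      · simp)
  have := card_le_generalUInvariant haniso htors
  simpa using this

/-- Every diagonal form is isometric to `⊥_q c q ⟨u q⟩` with unit forms `⟨u q⟩` and
with the `c q` in distinct classes of `vK/2vK`. -/
lemma exists_sigma_equivalent {n : ℕ} (a : Fin n → Kˣ) :
    ∃ (S : Finset (ValueClass v)) (ι : S → Type) (_ : ∀ q, Fintype (ι q)) (c : S → Kˣ)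
      (u : ∀ q, ι q → v.valuationSubring), (∀ q, valueClass v (c q) = q) ∧
      (∀ q i, residue v.valuationSubring (u q i) ≠ 0) ∧
      (diagonalForm fun i => (a i : K)).Equivalent
        (diagonalForm fun p : Σ q, ι q => (c p.1 : K) * (u p.1 p.2 : K)) := by
  classical
  let S := Finset.univ.image fun i => valueClass v (a i)
  let f : Fin n → S := fun i => ⟨valueClass v (a i), Finset.mem_image_of_mem _ (Finset.mem_univ i)⟩
  choose c hc using fun q : S => valueClass_surjective v q.1
  choose t ht0 ht using fun i => (valueClass_eq_iff v (a i) (c (f i))).1 (hc (f i)).symm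
  have hu1 : ∀ i, v (a i / (c (f i) * t i ^ 2)) = 1 := by
    intro i
    rw [map_div₀, map_mul, map_pow, ← ht i, div_self]
    exact (map_ne_zero v).2 (a i).ne_zero
  let u : Fin n → v.valuationSubring := fun i => ⟨a i / (c (f i) * t i ^ 2), (hu1 i).le⟩
  refine ⟨S, fun q => {i // f i = q}, inferInstance, c, fun q i => u i.1, hc,
    fun q i => (v.residue_ne_zero_iff _).2 (hu1 i.1), ?_⟩
  refine (diagonalForm_equivalent_of_mul_sq (w' := fun i => (c (f i) : K) * (u i : K)) ht0 ?_).trans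
    (diagonalForm_equivalent_of_equiv (Equiv.sigmaFiberEquiv f).symm fun i => rfl)
  intro i
  have := ht0 i
  simp only [u]
  field_simp

/-- An anisotropic torsion form over `K` is a sum of at most `[vK : 2vK]` scaled unit forms, each of
dimension at most `u(Kv)`. Indeed, the residue forms of the unit components are again
anisotropic torsion forms: the anisotropic parts of the residue forms of a hyperbolic multiple lift
to an anisotropic summand of a hyperbolic form, so they vanish. -/
lemma le_mul_generalUInvariant
    (hsq : ∀ x : K, v x < 1 → ∃ y : Kˣ, 1 + x = (y : K) ^ 2)
    (h2 : (2 : ResidueField v.valuationSubring) ≠ 0) {n : ℕ} {φ : QuadraticForm K (Fin n → K)}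
    (hφ : φ.Anisotropic) (ht : φ.IsTorsionForm) :
    (n : ℕ∞) ≤ valueGroupIndexTwo v * generalUInvariant (ResidueField v.valuationSubring) := by
  have h2K := two_ne_zero_of_residue v h2
  obtain ⟨a, ha, hφa⟩ := exists_diagonalForm_of_anisotropic h2K hφ
  obtain ⟨S, ι, _, c, u, hc, hu, hau⟩ := exists_sigma_equivalent v fun i => Units.mk0 (a i) (ha i)
  have hφu := hφa.trans hau
  obtain ⟨m, hm, hhyp⟩ := (isTorsionForm_diagonalForm_iff h2K).1 (ht.of_equivalent hφu)
  have hdist : ∀ q q' (t : K), t ≠ 0 → v (c q) = v (c q') * v t ^ 2 → q = q' := by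
    intro q q' t ht0 heq
    apply Subtype.ext
    rw [← hc q, ← hc q', valueClass_eq_iff]
    exact ⟨t, ht0, heq⟩
  have haniso : ∀ q, (diagonalForm fun i => residue v.valuationSubring (u q i)).Anisotropic :=
    fun q => anisotropic_residue v hsq h2 (hu q) (anisotropic_of_sigma
      (w := fun q i => (u q i : K)) (c := fun q => (c q : K)) (hφu.anisotropic hφ) q)
  choose l k b hb hub using fun q => exists_witt_decomposition h2
    (w := fun p : Fin m × ι q => residue v.valuationSubring (u q p.2)) fun p => hu q p.2
  choose b' hb' using fun q => v.exists_lift_weights (b q)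
  obtain rfl : (fun q k => residue v.valuationSubring (b' q k)) = b :=
    funext fun q => funext (hb' q)
  have hsum := diagonalForm_sigma_equivalent_of_residue v hsq h2
    (ι := fun q => Fin m × ι q) (u := fun q p => u q p.2)
    (fun q p => hu q p.2) hub (fun q => (c q : K))
  have hempty := isEmpty_of_isHyperbolic_sum h2K
    (anisotropic_sigma_of_residue v hb (fun q => (c q).ne_zero) hdist)
    (fun p : Σ q, Fin (k q) => (c p.1).ne_zero) (hhyp.of_equivalent
      ((diagonalForm_prod_sigma_equivalent m fun q i => (c q : K) * (u q i : K)).trans hsum))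
  have htors : ∀ q, (diagonalForm fun i => residue v.valuationSubring (u q i)).IsTorsionForm := by
    intro q
    refine (isTorsionForm_diagonalForm_iff h2).2 ⟨m, hm, ?_⟩
    have : IsEmpty (Fin (l q)) := ⟨fun i => hempty.elim ⟨q, i⟩⟩
    exact QuadraticForm.isHyperbolic_of_equivalent h2 (fun _ => one_ne_zero)
      ((hub q).trans (diagonalForm_equivalent_of_equiv (Equiv.emptySum _ _)
        (by
          rintro (i | _)
          · exact isEmptyElim i
          · simp)))
  have hn : n = ∑ q, Fintype.card (ι q) := by
    simpa using card_eq_of_diagonalForm_equivalent hau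
  calc (n : ℕ∞) = ∑ q, (Fintype.card (ι q) : ℕ∞) := by rw [hn]; push_cast; rfl
    _ ≤ ∑ _q : S, generalUInvariant (ResidueField v.valuationSubring) :=
        Finset.sum_le_sum fun q _ => card_le_generalUInvariant (haniso q) (htors q)
    _ = (S.card : ℕ∞) * generalUInvariant (ResidueField v.valuationSubring) := by simp
    _ ≤ _ := by
        refine mul_le_mul_left ?_ _
        have := ENat.card_le_card_of_injective (Subtype.val_injective (p := (· ∈ S)))
        rwa [ENat.card_eq_coe_fintype_card, Fintype.card_coe] at this

end Main

end

theorem proposition4 {K : Type*} [Field K] {Γ₀ : Type*} [LinearOrderedCommGroupWithZero Γ₀]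
    (v : Valuation K Γ₀)
    (hsq : ∀ x : K, v x < 1 → ∃ y : Kˣ, 1 + x = (y : K) ^ 2)
    (hchar : ringChar (IsLocalRing.ResidueField v.valuationSubring) ≠ 2) :
    generalUInvariant K =
      valueGroupIndexTwo v * generalUInvariant (IsLocalRing.ResidueField v.valuationSubring) := by
  have h2 : (2 : IsLocalRing.ResidueField v.valuationSubring) ≠ 0 := Ring.two_ne_zero hchar
  apply le_antisymm
  · refine sSup_le ?_
    rintro _ ⟨n, φ, hφ, ht, rfl⟩
    exact le_mul_generalUInvariant v hsq h2 hφ ht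
  · rw [generalUInvariant, ENat.mul_sSup]
    refine iSup₂_le ?_
    rintro _ ⟨d, ψ, hψ, ht, rfl⟩
    have key := fun S => card_mul_le_generalUInvariant v hsq h2 S hψ ht
    rcases finite_or_infinite (ValueClass v) with hfin | hinf
    · have := Fintype.ofFinite (ValueClass v)
      refine le_trans (le_of_eq ?_) (key Finset.univ)
      rw [Finset.card_univ, valueGroupIndexTwo, ENat.card_eq_coe_fintype_card]
    · rcases Nat.eq_zero_or_pos d with rfl | hd
      · simp
      · refine le_top.trans_eq (Eq.symm (ENat.eq_top_iff_forall_ge.2 fun n => ?_))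
        obtain ⟨S, -, hS⟩ := Set.infinite_univ (α := ValueClass v) |>.exists_subset_card_eq n
        refine le_trans ?_ (key S)
        rw [hS]
        exact_mod_cast Nat.le_mul_of_pos_right n hd
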